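/- Let $\mathcal A=\{A_0,A_1,\dots,A_d\}$ be a symmetric association scheme with $d$ classes on a vertex set of size $n$. That is, the $A_i$ are nonzero symmetric $n\times n$ matrices with entries in $\{0,1\}$ such that $A_0=I$, $A_0+A_1+\dots+A_d$ is the all-ones matrix $\mathbf J$, and for all $i,j$ one has $A_iA_j=A_jA_i=\sum_{k=0}^d p_{i,j}^kA_k$ with nonnegative integers $p_{i,j}^k$. Let $E_0=\frac1n \mathbf J,E_1,\dots,E_d$ be the primitive idempotents of the scheme (in any order of $E_1,\dots,E_d$), i.e. the basis of the Bose–Mesner algebra (the complex matrix algebra generated by $A_0,\dots,A_d$) with $E_iE_j=\delta_{i,j}E_i$ and $\sum_{i=0}^d E_i=I$. Define $P_j(i)$ and $Q_j(i)$ by $$A_j=\sum_{i=0}^dP_j(i)E_i,\qquad E_j=\frac1n\sum_{i=0}^dQ_j(i)A_i\qquad(0\le j\le d),$$ and put $m_i=Q_i(0)$. For a simple graph $G$ on $n$ vertices, let $\mathcal S(G)$ be the set of real symmetric $n\times n$ matrices $M$, indexed by the vertices, such that for all $x\ne y$ one has $M_{xy}=0$ if and only if $\{x,y\}$ is not an edge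 of $G$ (the diagonal entries are arbitrary). Let $q(G)$ be the minimum, over $M\in\mathcal S(G)$, of the number of distinct eigenvalues of $M$. Let $I\subsetneq\{0,1,\dots,d\}$ and $J\subseteq\{1,2,\dots,d\}$ be such that, for every $j\in\{0,1,\dots,d\}$, $$\sum_{i\in I}\frac{m_iP_j(i)}{P_j(0)}\neq0\quad\text{if and only if}\quad j\in J\cup\{0\}.$$ Let $G_J$ be the graph with adjacency matrix $A_J=\sum_{j\in J}A_j$. Then $E_I=\sum_{i\in I}E_i$ is an idempotent matrix contained in $\mathcal S(G_J)$ (in particular, $E_I$ is real). Consequently, $q(G_J)=2$. -/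

import Mathlib

/-- A (commutative) association scheme with `d` classes on the finite vertex set `V`:
`0`-`1` matrices `A 0, …, A d`, none of them zero (so that they are `d + 1` distinct, linearly
independent matrices), with `A 0 = I`, with sum the all-ones matrix, closed under transposition,
and commuting with each other with products that are nonnegative integer combinations of the
`A k`. -/
structure AssocScheme (V : Type*) [Fintype V] [DecidableEq V] (d : ℕ) where
  A : Fin (d + 1) → Matrix V V ℂ
  zero_or_one : ∀ i x y, A i x y = 0 ∨ A i x y = 1
  ne_zero : ∀ i, A i ≠ 0
  A_zero : A 0 = 1
  sum_A : ∑ i, A i = Matrix.of fun _ _ => 1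
  transpose_mem : ∀ i, ∃ i', (A i).transpose = A i'
  mul_comm_A : ∀ i j, A i * A j = A j * A i
  mul_A : ∀ i j, ∃ p : Fin (d + 1) → ℕ, A i * A j = ∑ k, (p k : ℂ) • A k

namespace AssocScheme

variable {V : Type*} [Fintype V] [DecidableEq V] {d : ℕ}

/-- A scheme is symmetric if all its matrices are. -/
def IsSymmetric (S : AssocScheme V d) : Prop :=
  ∀ i, (S.A i).transpose = S.A i

/-- The Bose-Mesner algebra: the complex matrix algebra generated by `A 0, …, A d`. -/
def boseMesner (S : AssocScheme V d) : Subalgebra ℂ (Matrix V V ℂ) :=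
  Algebra.adjoin ℂ (Set.range S.A)

theorem A_mem (S : AssocScheme V d) (i : Fin (d + 1)) : S.A i ∈ S.boseMesner :=
  Algebra.subset_adjoin ⟨i, rfl⟩

/-- Two of the matrices have no common nonzero entry. -/
theorem A_apply_eq_zero (S : AssocScheme V d) {i j : Fin (d + 1)} (hij : i ≠ j) {x y : V}
    (h : S.A i x y = 1) : S.A j x y = 0 := by
  have hnat : ∀ k, ∃ m : ℕ, S.A k x y = m := fun k =>
    (S.zero_or_one k x y).elim (fun h => ⟨0, by simp [h]⟩) (fun h => ⟨1, by simp [h]⟩)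
  choose f hf using hnat
  have hs : ∑ k, S.A k x y = 1 := by
    have := congrFun (congrFun S.sum_A x) y
    simpa [Matrix.sum_apply] using this
  simp only [hf] at hs h ⊢
  have hs' : ∑ k, f k = 1 := by exact_mod_cast hs
  have h' : f i = 1 := by exact_mod_cast h
  have h2 : f i + f j ≤ ∑ k, f k := by
    rw [← Finset.sum_pair hij]
    exact Finset.sum_le_sum_of_subset (Finset.subset_univ _)
  have : f j = 0 := by omega
  simp [this]

theorem linearIndependent_A (S : AssocScheme V d) : LinearIndependent ℂ S.A := by
  rw [Fintype.linearIndependent_iff]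
  intro g hg i
  obtain ⟨x, y, hxy⟩ : ∃ x y, S.A i x y ≠ 0 := by
    by_contra! h
    exact S.ne_zero i (by ext x y; exact h x y)
  have h1 := (S.zero_or_one i x y).resolve_left hxy
  have := congrFun (congrFun hg x) y
  rw [Matrix.sum_apply, Finset.sum_eq_single i] at this
  · simpa [h1] using this
  · intro j _ hj
    simp [S.A_apply_eq_zero hj.symm h1]
  · simp

/-- The Bose-Mesner algebra is the complex linear span of the matrices of the scheme. -/
theorem boseMesner_toSubmodule (S : AssocScheme V d) :
    Subalgebra.toSubmodule S.boseMesner = Submodule.span ℂ (Set.range S.A) := by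
  apply le_antisymm
  · have hone : (1 : Matrix V V ℂ) ∈ Submodule.span ℂ (Set.range S.A) :=
      Submodule.subset_span ⟨0, S.A_zero⟩
    have hmul : ∀ x y, x ∈ Submodule.span ℂ (Set.range S.A) →
        y ∈ Submodule.span ℂ (Set.range S.A) → x * y ∈ Submodule.span ℂ (Set.range S.A) := by
      intro x y hx hy
      have hxy : x * y ∈ Submodule.span ℂ (Set.range S.A) * Submodule.span ℂ (Set.range S.A) :=
        Submodule.mul_mem_mul hx hy
      rw [Submodule.span_mul_span] at hxy
      refine Submodule.span_le.2 ?_ hxy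
      rintro _ ⟨_, ⟨i, rfl⟩, _, ⟨j, rfl⟩, rfl⟩
      obtain ⟨p, hp⟩ := S.mul_A i j
      change S.A i * S.A j ∈ Submodule.span ℂ (Set.range S.A)
      rw [hp]
      exact Submodule.sum_mem _ fun k _ => Submodule.smul_mem _ _ (Submodule.subset_span ⟨k, rfl⟩)
    exact Algebra.adjoin_le (S := (Submodule.span ℂ (Set.range S.A)).toSubalgebra hone hmul)
      Submodule.subset_span
  · exact Submodule.span_le.2 fun x hx => Algebra.subset_adjoin hx

/-- The basis `A 0, …, A d` of the Bose-Mesner algebra. -/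
noncomputable def basisA (S : AssocScheme V d) :
    Module.Basis (Fin (d + 1)) ℂ S.boseMesner :=
  (Module.Basis.span S.linearIndependent_A).map
    (LinearEquiv.ofEq _ _ S.boseMesner_toSubmodule.symm)

theorem coe_basisA (S : AssocScheme V d) (i : Fin (d + 1)) :
    (S.basisA i : Matrix V V ℂ) = S.A i := by
  have h := Module.Basis.span_apply S.linearIndependent_A i
  exact congrArg Subtype.val h

/-- An enumeration `E 0, …, E d` of the primitive idempotents of a scheme: a basis of the
Bose-Mesner algebra with `E 0 = (1 / n) J`, `E i * E j = δ_{ij} E i`, `∑ i, E i = I`, and closed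
under transposition. -/
structure IdempotentBasis (S : AssocScheme V d) where
  basis : Module.Basis (Fin (d + 1)) ℂ S.boseMesner
  basis_zero : (basis 0 : Matrix V V ℂ) = (1 / (Fintype.card V : ℂ)) • Matrix.of fun _ _ => 1
  basis_mul : ∀ i j, basis i * basis j = if i = j then basis i else 0
  sum_basis : ∑ i, basis i = 1
  transpose_mem : ∀ i, ∃ i', (basis i : Matrix V V ℂ).transpose = basis i'

namespace IdempotentBasis

variable {S : AssocScheme V d}

/-- The primitive idempotent `E_i`. -/
noncomputable def E (B : S.IdempotentBasis) (i : Fin (d + 1)) : Matrix V V ℂ := B.basis i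

/-- `B.P j i` is the entry `P_j(i)` of the first eigenmatrix: `A_j = ∑ i, P_j(i) E_i`. -/
noncomputable def P (B : S.IdempotentBasis) (j i : Fin (d + 1)) : ℂ :=
  B.basis.repr ⟨S.A j, S.A_mem j⟩ i

/-- `B.Q j i` is the entry `Q_j(i)` of the second eigenmatrix: `E_j = (1 / n) ∑ i, Q_j(i) A_i`. -/
noncomputable def Q (B : S.IdempotentBasis) (j i : Fin (d + 1)) : ℂ :=
  (Fintype.card V : ℂ) * S.basisA.repr (B.basis j) i

/-- The multiplicity `m_i = Q_i(0)`. -/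
noncomputable def m (B : S.IdempotentBasis) (i : Fin (d + 1)) : ℂ := B.Q i 0

/-- The idempotent `E_I = ∑_{i ∈ I} E_i`. -/
noncomputable def EI (B : S.IdempotentBasis) (I : Finset (Fin (d + 1))) : Matrix V V ℂ :=
  ∑ i ∈ I, B.E i

theorem A_eq_sum (B : S.IdempotentBasis) (j : Fin (d + 1)) :
    S.A j = ∑ i, B.P j i • B.E i := by
  have h := congrArg S.boseMesner.val (B.basis.sum_repr ⟨S.A j, S.A_mem j⟩)
  simp only [map_sum, map_smul] at h
  exact h.symm

theorem E_eq_sum (B : S.IdempotentBasis) (j : Fin (d + 1)) :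
    B.E j = (1 / (Fintype.card V : ℂ)) • ∑ i, B.Q j i • S.A i := by
  have hn : (Fintype.card V : ℂ) ≠ 0 := by
    intro h
    have : IsEmpty V := Fintype.card_eq_zero_iff.1 (by exact_mod_cast h)
    exact S.ne_zero 0 (by ext x; exact this.elim x)
  have h := congrArg S.boseMesner.val (S.basisA.sum_repr (B.basis j))
  simp only [map_sum, map_smul, Subalgebra.val_apply, coe_basisA] at h
  rw [Finset.smul_sum]
  simp only [Q, smul_smul, E, ← mul_assoc, one_div, inv_mul_cancel₀ hn, one_mul]
  exact h.symm

end IdempotentBasis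

/-- A finite-dimensional reduced commutative complex algebra has a basis of orthogonal
idempotents with sum `1`. -/
theorem exists_idempotent_basis (R : Type*) [CommRing R] [Algebra ℂ R] [Module.Finite ℂ R]
    (hR : ∀ x : R, x * x = 0 → x = 0) :
    ∃ (n : ℕ) (b : Module.Basis (Fin n) ℂ R),
      (∀ k l, b k * b l = if k = l then b k else 0) ∧ ∑ k, b k = 1 := by
  classical
  have hart : IsArtinianRing R := IsArtinianRing.of_finite ℂ R
  have hred : IsReduced R := by
    rw [isReduced_iff_pow_one_lt 2 (by norm_num)]
    intro x hx
    exact hR x (by rw [← sq, hx])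
  let φ := (IsArtinianRing.equivPi R).toRingEquiv
  let e : MaximalSpectrum R → R := fun k => φ.symm (Pi.single k 1)
  let inst : Fintype (MaximalSpectrum R) := Fintype.ofFinite (MaximalSpectrum R)
  have he : ∀ k, φ (e k) = Pi.single k 1 := fun k => φ.apply_symm_apply _
  have emul : ∀ k l, e k * e l = if k = l then e k else 0 := by
    intro k l
    apply φ.injective
    rw [map_mul, he, he]
    split_ifs with h
    · subst h
      rw [he, ← Pi.single_mul, one_mul]
    · rw [map_zero]
      ext t
      by_cases hk : t = k
      · subst hk
        simp [Pi.single_eq_of_ne h]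
      · simp [Pi.single_eq_of_ne hk]
  have esum : ∑ k, e k = 1 := by
    apply φ.injective
    rw [map_sum, map_one]
    simp only [he]
    exact Finset.univ_sum_single (1 : ∀ k : MaximalSpectrum R, _ ⧸ k.asIdeal)
  have ene : ∀ k, e k ≠ 0 := by
    intro k hk
    have h := congrArg φ hk
    rw [he, map_zero] at h
    have h2 := congrFun h k
    rw [Pi.single_eq_same] at h2
    have := Ideal.Quotient.nontrivial_iff.2 k.isMaximal.ne_top
    exact one_ne_zero h2
  have escal : ∀ (x : R) k, ∃ c : ℂ, x * e k = c • e k := by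
    intro x k
    have hmax := k.isMaximal
    have hdom : IsDomain (R ⧸ k.asIdeal) := Ideal.Quotient.isDomain k.asIdeal
    have hbij : Function.Bijective (algebraMap ℂ (R ⧸ k.asIdeal)) :=
      IsAlgClosed.algebraMap_bijective_of_isIntegral
    obtain ⟨c, hc⟩ := hbij.2 (φ x k)
    refine ⟨c, ?_⟩
    apply φ.injective
    rw [Algebra.smul_def, map_mul, map_mul, he]
    ext t
    by_cases ht : t = k
    · subst ht
      rw [Pi.mul_apply, Pi.mul_apply, ← hc]
      rfl
    · simp [Pi.single_eq_of_ne ht]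
  have eli : LinearIndependent ℂ e := by
    rw [Fintype.linearIndependent_iff]
    intro g hg k
    have h := congrArg (· * e k) hg
    simp only [Finset.sum_mul, smul_mul_assoc, emul, zero_mul] at h
    rw [Finset.sum_eq_single k (fun l _ hl => by simp [hl]) (by simp)] at h
    simpa [ene k] using h
  have espan : ⊤ ≤ Submodule.span ℂ (Set.range e) := by
    intro x _
    have : x = ∑ k, x * e k := by rw [← Finset.mul_sum, esum, mul_one]
    rw [this]
    refine Submodule.sum_mem _ fun k _ => ?_
    obtain ⟨c, hc⟩ := escal x k
    rw [hc]
    exact Submodule.smul_mem _ _ (Submodule.subset_span ⟨k, rfl⟩)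
  let f := Fintype.equivFin (MaximalSpectrum R)
  refine ⟨_, (Module.Basis.mk eli espan).reindex f, ?_, ?_⟩
  · intro k l
    simp [emul]
  · rw [← esum, ← f.symm.sum_comp]
    simp

/-- The primitive idempotents of a symmetric scheme exist. -/
theorem nonempty_idempotentBasis (S : AssocScheme V d) (hS : S.IsSymmetric) :
    Nonempty S.IdempotentBasis := by
  classical
  have hfin : Module.Finite ℂ S.boseMesner := Module.Finite.of_basis S.basisA
  have hsum : ∀ x : S.boseMesner, (x : Matrix V V ℂ) = ∑ i, S.basisA.repr x i • S.A i := by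
    intro x
    have h := congrArg S.boseMesner.val (S.basisA.sum_repr x)
    simp only [map_sum, map_smul, Subalgebra.val_apply, coe_basisA] at h
    exact h.symm
  have hcomm : ∀ x y : S.boseMesner, x * y = y * x := by
    intro x y
    apply Subtype.ext
    rw [MulMemClass.coe_mul, MulMemClass.coe_mul, hsum x, hsum y]
    simp only [Finset.sum_mul, Finset.mul_sum, smul_mul_assoc, mul_smul_comm, Finset.smul_sum]
    rw [Finset.sum_comm]
    refine Finset.sum_congr rfl fun i _ => Finset.sum_congr rfl fun j _ => ?_
    rw [S.mul_comm_A, smul_comm]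
  have hsymm : ∀ x : S.boseMesner, (x : Matrix V V ℂ).transpose = x := by
    intro x
    rw [hsum x, Matrix.transpose_sum]
    exact Finset.sum_congr rfl fun i _ => by rw [Matrix.transpose_smul, hS i]
  have hconj : ∀ x : S.boseMesner, (x : Matrix V V ℂ).conjTranspose ∈ S.boseMesner := by
    intro x
    rw [hsum x, Matrix.conjTranspose_sum]
    refine Subalgebra.sum_mem _ fun i _ => ?_
    have hA : (S.A i).conjTranspose = S.A i := by
      ext a b
      have h1 := congrFun (congrFun (hS i) a) b
      rw [Matrix.transpose_apply] at h1
      rw [Matrix.conjTranspose_apply, h1]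
      rcases S.zero_or_one i a b with h | h <;> simp [h]
    rw [Matrix.conjTranspose_smul, hA]
    exact Subalgebra.smul_mem _ (S.A_mem i) _
  have hred : ∀ x : S.boseMesner, x * x = 0 → x = 0 := by
    open scoped ComplexOrder in
    intro x hx
    let z : S.boseMesner := ⟨_, hconj x⟩
    have hzx : (z * x) * (z * x) = 0 := by
      rw [hcomm z x, mul_assoc, ← mul_assoc z x z, hcomm z x, mul_assoc x z z, ← mul_assoc, hx,
        zero_mul]
    have h0 : (x : Matrix V V ℂ).conjTranspose * x = 0 := by
      apply Matrix.conjTranspose_mul_self_eq_zero.1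
      rw [Matrix.conjTranspose_mul, Matrix.conjTranspose_conjTranspose]
      exact congrArg Subtype.val hzx
    exact Subtype.ext (Matrix.conjTranspose_mul_self_eq_zero.1 h0)
  obtain ⟨N, b, bmul, bsum⟩ := @exists_idempotent_basis S.boseMesner
    { (inferInstance : Ring S.boseMesner) with mul_comm := hcomm } _ hfin hred
  have hN : N = d + 1 := by
    have h1 := Module.finrank_eq_card_basis b
    have h2 := Module.finrank_eq_card_basis S.basisA
    simpa using h1.symm.trans h2
  subst hN
  -- locate the all-ones idempotent among the `b k`
  have hn : (Fintype.card V : ℂ) ≠ 0 := by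
    intro h
    have : IsEmpty V := Fintype.card_eq_zero_iff.1 (by exact_mod_cast h)
    exact S.ne_zero 0 (by ext x; exact this.elim x)
  let p : S.boseMesner := ⟨(1 / (Fintype.card V : ℂ)) • Matrix.of fun _ _ => 1, by
    rw [← S.sum_A]
    exact Subalgebra.smul_mem _ (Subalgebra.sum_mem _ fun i _ => S.A_mem i) _⟩
  have hpp : p * p = p := by
    apply Subtype.ext
    ext x y
    simp [p, Matrix.mul_apply, hn]
  have hp0 : p ≠ 0 := by
    intro h
    have hV : Nonempty V := by
      rw [← Fintype.card_pos_iff]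
      exact Nat.pos_of_ne_zero (by exact_mod_cast hn)
    obtain ⟨v⟩ := hV
    have h1 := congrFun (congrFun (congrArg Subtype.val h) v) v
    simp [p, hn] at h1
  have hAp : ∀ i, ∃ c : ℂ, S.A i * (p : Matrix V V ℂ) = c • (p : Matrix V V ℂ) := by
    intro i
    obtain ⟨q, hq⟩ := S.mul_A i i
    refine ⟨q 0, ?_⟩
    ext x y
    have hrow : ∑ z, S.A i x z = q 0 := by
      have h := congrFun (congrFun hq x) x
      rw [Matrix.mul_apply, Matrix.sum_apply,
        Finset.sum_eq_single (M := ℂ) (s := (Finset.univ : Finset (Fin (d + 1)))) 0] at h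
      · rw [Matrix.smul_apply, S.A_zero, Matrix.one_apply_eq, smul_eq_mul, mul_one] at h
        rw [← h]
        refine Finset.sum_congr rfl fun z _ => ?_
        have h1 := congrFun (congrFun (hS i) x) z
        rw [Matrix.transpose_apply] at h1
        rw [h1]
        rcases S.zero_or_one i x z with h | h <;> simp [h]
      · intro k _ hk
        rw [Matrix.smul_apply, S.A_apply_eq_zero hk.symm (by simp [S.A_zero]), smul_zero]
      · simp
    simp [p, Matrix.mul_apply, ← Finset.sum_mul, hrow]
  have hxp : ∀ x : S.boseMesner, ∃ c : ℂ, x * p = c • p := by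
    intro x
    choose c hc using hAp
    refine ⟨∑ i, S.basisA.repr x i * c i, Subtype.ext ?_⟩
    rw [MulMemClass.coe_mul, hsum x, Finset.sum_mul, Finset.sum_smul]
    simp only [smul_mul_assoc, hc, smul_smul]
    simp
  obtain ⟨k, hk⟩ : ∃ k, b k * p ≠ 0 := by
    by_contra! h
    apply hp0
    rw [← one_mul p, ← bsum, Finset.sum_mul]
    exact Finset.sum_eq_zero fun k _ => h k
  have hkp : b k * p = p := by
    obtain ⟨c, hc⟩ := hxp (b k)
    have h1 : b k * (b k * p) = b k * p := by rw [← mul_assoc, bmul, if_pos rfl]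
    rw [hc, mul_smul_comm, hc, smul_smul] at h1
    have hc0 : c ≠ 0 := by
      rintro rfl
      exact hk (by rw [hc, zero_smul])
    have h2 : (c * c - c) • p = 0 := by rw [sub_smul, h1, sub_self]
    have h3 : c * c - c = 0 := (smul_eq_zero.1 h2).resolve_right hp0
    have h4 : c = 1 := mul_left_cancel₀ hc0 (by rw [mul_one]; exact sub_eq_zero.1 h3)
    rw [hc, h4, one_smul]
  have hbp : b k = p := by
    have h1 : b k * p = b.repr p k • b k := by
      conv_lhs => rw [← b.sum_repr p]
      rw [Finset.mul_sum, Finset.sum_eq_single k]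
      · rw [mul_smul_comm, bmul, if_pos rfl]
      · intro l _ hl
        rw [mul_smul_comm, bmul, if_neg hl.symm, smul_zero]
      · simp
    rw [hkp] at h1
    have h2 : b.repr p k • p = p := by
      conv_rhs => rw [← hpp, h1, smul_mul_assoc, ← h1, hkp]
    have h3 : (b.repr p k - 1) • p = 0 := by rw [sub_smul, h2, one_smul, sub_self]
    have h4 : b.repr p k = 1 := sub_eq_zero.1 ((smul_eq_zero.1 h3).resolve_right hp0)
    rw [h4, one_smul] at h1
    exact h1.symm
  refine ⟨⟨b.reindex (Equiv.swap k 0), ?_, ?_, ?_, ?_⟩⟩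
  · simp [hbp, p]
  · intro i j
    simp [bmul]
  · rw [← bsum, ← (Equiv.swap k 0).symm.sum_comp b]
    simp
  · exact fun i => ⟨i, hsymm _⟩

/-- For a symmetric scheme and `J ⊆ {1, …, d}`, the matrix `A_J = ∑_{j ∈ J} A_j` is the
adjacency matrix of a graph. -/
theorem isAdjMatrix_sum (S : AssocScheme V d) (hS : S.IsSymmetric) (J : Finset (Fin (d + 1)))
    (hJ : 0 ∉ J) : (∑ j ∈ J, S.A j).IsAdjMatrix where
  zero_or_one x y := by
    rw [Matrix.sum_apply]
    by_cases h : ∃ j ∈ J, S.A j x y = 1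
    · obtain ⟨j, hj, h1⟩ := h
      right
      rw [Finset.sum_eq_single_of_mem j hj fun k _ hk => S.A_apply_eq_zero hk.symm h1, h1]
    · push Not at h
      left
      exact Finset.sum_eq_zero fun j hj => (S.zero_or_one j x y).resolve_right (h j hj)
  symm := by
    rw [Matrix.IsSymm, Matrix.transpose_sum]
    exact Finset.sum_congr rfl fun j _ => hS j
  apply_diag x := by
    rw [Matrix.sum_apply]
    refine Finset.sum_eq_zero fun j hj => S.A_apply_eq_zero (i := 0) ?_ (by simp [S.A_zero])
    rintro rfl
    exact hJ hj

/-- The graph `G_J` in a symmetric scheme, whose adjacency matrix is `A_J = ∑_{j ∈ J} A_j`. -/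
def graph (S : AssocScheme V d) (hS : S.IsSymmetric) (J : Finset (Fin (d + 1)))
    (hJ : 0 ∉ J) : SimpleGraph V :=
  (S.isAdjMatrix_sum hS J hJ).toGraph

open Classical in
theorem adjMatrix_graph (S : AssocScheme V d) (hS : S.IsSymmetric) (J : Finset (Fin (d + 1)))
    (hJ : 0 ∉ J) : (S.graph hS J hJ).adjMatrix ℂ = ∑ j ∈ J, S.A j := by
  ext x y
  have := (S.isAdjMatrix_sum hS J hJ).zero_or_one x y
  rw [SimpleGraph.adjMatrix_apply]
  change (if (∑ j ∈ J, S.A j) x y = 1 then (1 : ℂ) else 0) = _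
  rcases this with h | h <;> simp [h]

end AssocScheme

/-- `𝒮(G)`: the real symmetric matrices whose off-diagonal entries are nonzero exactly at the
edges of `G`; the diagonal is arbitrary. -/
def graphMatrices {V : Type*} (G : SimpleGraph V) : Set (Matrix V V ℝ) :=
  {M | M.IsSymm ∧ ∀ x y, x ≠ y → (M x y = 0 ↔ ¬ G.Adj x y)}

/-- `q(M)`: the number of distinct eigenvalues of a real square matrix. -/
noncomputable def numEigenvalues {V : Type*} [Fintype V] [DecidableEq V]
    (M : Matrix V V ℝ) : ℕ :=
  {μ : ℝ | Module.End.HasEigenvalue (Matrix.toLin' M) μ}.ncard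

/-- `q(G)`: the minimum number of distinct eigenvalues of a matrix in `𝒮(G)`. -/
noncomputable def minNumEigenvalues {V : Type*} [Fintype V] [DecidableEq V]
    (G : SimpleGraph V) : ℕ :=
  sInf (numEigenvalues '' graphMatrices G)

/-!
The heart of the argument is the duality `Q_i(j) P_j(0) = m_i P_j(i)` between the two
eigenmatrices (`Q_mul_P_zero`): both sides are the trace of `A_j E_i`, evaluated once through
`A_j E_i = P_j(i) E_i` and once entry by entry, since `E_i` is constant on the support of `A_j`.
Hence the entry of `E_I` on the support of `A_j` is `1 / n` times the sum in the hypothesis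
(`EI_apply`), so that off the diagonal `E_I` vanishes exactly at the non-edges of `G_J`.

Each `E_i` is real: its conjugate transpose is a multiple of `E_i`, because `E_i* E_i` is both a
multiple of `E_i` and Hermitian, and the multiple is `1` because both are nonzero idempotents
(`conjTranspose_E`). So `E_I` comes from a real symmetric idempotent, whose spectrum lies in
`{0, 1}`, and `q(G_J) ≤ 2`. Conversely `J` is nonempty, as otherwise `E_I` would be scalar, which
is impossible for a nonempty proper `I`. So `G_J` has an edge, no matrix of `𝒮(G_J)` is scalar, and
a real symmetric matrix with fewer than two eigenvalues is scalar.
-/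

/-! ### The relations of a scheme -/

namespace AssocScheme

variable {V : Type*} [Fintype V] [DecidableEq V] {d : ℕ}

theorem card_ne_zero (S : AssocScheme V d) : (Fintype.card V : ℂ) ≠ 0 := by
  intro h
  have : IsEmpty V := Fintype.card_eq_zero_iff.1 (by exact_mod_cast h)
  exact S.ne_zero 0 (by ext x; exact this.elim x)

theorem exists_apply_eq_one (S : AssocScheme V d) (j : Fin (d + 1)) : ∃ x y, S.A j x y = 1 := by
  by_contra! h
  exact S.ne_zero j (by ext x y; exact (S.zero_or_one j x y).resolve_right (h x y))

/-- The relations of a scheme cover all pairs of vertices. -/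
theorem exists_rel (S : AssocScheme V d) (x y : V) : ∃ j, S.A j x y = 1 := by
  by_contra! h
  have hs := congrFun (congrFun S.sum_A x) y
  rw [Matrix.sum_apply, Finset.sum_eq_zero fun j _ => (S.zero_or_one j x y).resolve_right (h j)]
    at hs
  simp at hs

theorem sum_smul_apply (S : AssocScheme V d) (c : Fin (d + 1) → ℂ) {j : Fin (d + 1)} {x y : V}
    (h : S.A j x y = 1) : (∑ i, c i • S.A i) x y = c j := by
  rw [Matrix.sum_apply, Finset.sum_eq_single j]
  · simp [h]
  · intro k _ hk
    simp [S.A_apply_eq_zero hk.symm h]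
  · simp

theorem A_apply_swap {S : AssocScheme V d} (hS : S.IsSymmetric) (j : Fin (d + 1)) (x y : V) :
    S.A j y x = S.A j x y :=
  congrFun (congrFun (hS j) x) y

/-! ### Duality of the eigenmatrices and the entries of the idempotents -/

namespace IdempotentBasis

variable {S : AssocScheme V d} (B : S.IdempotentBasis)

theorem E_mul_E (i j : Fin (d + 1)) : B.E i * B.E j = if i = j then B.E i else 0 := by
  have h := congrArg Subtype.val (B.basis_mul i j)
  rw [MulMemClass.coe_mul] at h
  refine h.trans ?_
  split_ifs <;> rfl

theorem E_ne_zero (i : Fin (d + 1)) : B.E i ≠ 0 := fun h =>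
  B.basis.ne_zero i (Subtype.ext h)

/-- Every element of the Bose-Mesner algebra acts on `E i` as a scalar. -/
theorem exists_mul_E_eq_smul {X : Matrix V V ℂ} (hX : X ∈ S.boseMesner) (i : Fin (d + 1)) :
    ∃ c : ℂ, X * B.E i = c • B.E i := by
  refine ⟨B.basis.repr ⟨X, hX⟩ i, ?_⟩
  have h := congrArg S.boseMesner.val (B.basis.sum_repr ⟨X, hX⟩)
  simp only [map_sum, map_smul] at h
  change ∑ k, B.basis.repr ⟨X, hX⟩ k • B.E k = X at h
  conv_lhs => rw [← h]
  simp [Finset.sum_mul, E_mul_E]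

theorem A_mul_E (j i : Fin (d + 1)) : S.A j * B.E i = B.P j i • B.E i := by
  conv_lhs => rw [B.A_eq_sum j]
  simp [Finset.sum_mul, E_mul_E]

theorem E_zero_apply (x y : V) : B.E 0 x y = 1 / (Fintype.card V : ℂ) := by
  have h := congrFun (congrFun B.basis_zero x) y
  exact h.trans (by simp)

/-- `P_j(0)` is the valency of the `j`-th relation. -/
theorem sum_row_A (j : Fin (d + 1)) (x : V) : ∑ y, S.A j x y = B.P j 0 := by
  have h := congrFun (congrFun (B.A_mul_E j 0) x) x
  simp only [Matrix.mul_apply, E_zero_apply, Matrix.smul_apply, smul_eq_mul,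
    ← Finset.sum_mul] at h
  exact mul_right_cancel₀ (one_div_ne_zero S.card_ne_zero) h

theorem P_zero_ne_zero (j : Fin (d + 1)) : B.P j 0 ≠ 0 := by
  obtain ⟨x, y, hxy⟩ := S.exists_apply_eq_one j
  have hnat : ∀ z, ∃ k : ℕ, S.A j x z = k := fun z =>
    (S.zero_or_one j x z).elim (fun h => ⟨0, by simp [h]⟩) (fun h => ⟨1, by simp [h]⟩)
  choose f hf using hnat
  rw [← B.sum_row_A j x]
  simp only [hf] at hxy ⊢
  have h1 : f y = 1 := by exact_mod_cast hxy
  have h2 : f y ≤ ∑ z, f z := Finset.single_le_sum (fun _ _ => Nat.zero_le _) (Finset.mem_univ y)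
  have h3 : ∑ z, f z ≠ 0 := by omega
  exact_mod_cast h3

/-- The idempotent `E_i` is constant on the support of `A_j`, with value `Q_i(j) / n`. -/
theorem E_apply (i : Fin (d + 1)) {j : Fin (d + 1)} {x y : V} (h : S.A j x y = 1) :
    B.E i x y = 1 / (Fintype.card V : ℂ) * B.Q i j := by
  rw [B.E_eq_sum i, Matrix.smul_apply, S.sum_smul_apply _ h, smul_eq_mul]

theorem trace_E (i : Fin (d + 1)) : (B.E i).trace = B.m i := by
  have h : ∀ x, B.E i x x = 1 / (Fintype.card V : ℂ) * B.m i := fun x =>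
    B.E_apply i (by simp [S.A_zero])
  simp [Matrix.trace, h, S.card_ne_zero]

/-- Duality of the two eigenmatrices: both sides are the trace of `A_j E_i`. -/
theorem Q_mul_P_zero (hS : S.IsSymmetric) (i j : Fin (d + 1)) :
    B.Q i j * B.P j 0 = B.m i * B.P j i := by
  have h1 : (S.A j * B.E i).trace = B.m i * B.P j i := by
    rw [B.A_mul_E, Matrix.trace_smul, B.trace_E, smul_eq_mul, mul_comm]
  have h2 : ∀ x y, S.A j x y * B.E i y x =
      S.A j x y * (1 / (Fintype.card V : ℂ) * B.Q i j) := by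
    intro x y
    rcases S.zero_or_one j x y with h | h
    · simp [h]
    · rw [B.E_apply i ((A_apply_swap hS j x y).trans h)]
  rw [← h1]
  simp only [Matrix.trace, Matrix.diag_apply, Matrix.mul_apply, h2, ← Finset.sum_mul,
    B.sum_row_A, Finset.sum_const, Finset.card_univ, nsmul_eq_mul]
  field_simp [S.card_ne_zero]

/-- The entries of `E_I` on the support of `A_j`. -/
theorem EI_apply (hS : S.IsSymmetric) (I : Finset (Fin (d + 1))) {j : Fin (d + 1)} {x y : V}
    (h : S.A j x y = 1) :
    B.EI I x y = 1 / (Fintype.card V : ℂ) * ∑ i ∈ I, B.m i * B.P j i / B.P j 0 := by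
  rw [EI, Matrix.sum_apply, Finset.mul_sum]
  refine Finset.sum_congr rfl fun i _ => ?_
  rw [B.E_apply i h, ← B.Q_mul_P_zero hS, mul_div_cancel_right₀ _ (B.P_zero_ne_zero j)]

theorem EI_mul_E (I : Finset (Fin (d + 1))) (k : Fin (d + 1)) :
    B.EI I * B.E k = if k ∈ I then B.E k else 0 := by
  simp [EI, Finset.sum_mul, E_mul_E]

theorem isIdempotentElem_EI (I : Finset (Fin (d + 1))) : IsIdempotentElem (B.EI I) := by
  change B.EI I * ∑ k ∈ I, B.E k = ∑ k ∈ I, B.E k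
  rw [Finset.mul_sum]
  exact Finset.sum_congr rfl fun k hk => by rw [B.EI_mul_E, if_pos hk]

/-! ### The idempotents of a symmetric scheme are real -/

theorem transpose_E (hS : S.IsSymmetric) (i : Fin (d + 1)) : (B.E i).transpose = B.E i := by
  rw [B.E_eq_sum i, Matrix.transpose_smul, Matrix.transpose_sum]
  simp only [Matrix.transpose_smul, hS _]

theorem conjTranspose_E_mem (hS : S.IsSymmetric) (i : Fin (d + 1)) :
    (B.E i).conjTranspose ∈ S.boseMesner := by
  have hA : ∀ j, (S.A j).conjTranspose = S.A j := by
    intro j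
    ext x y
    rw [Matrix.conjTranspose_apply, A_apply_swap hS j x y]
    rcases S.zero_or_one j x y with h | h <;> simp [h]
  rw [B.E_eq_sum i, Matrix.conjTranspose_smul, Matrix.conjTranspose_sum]
  refine Subalgebra.smul_mem _ (Subalgebra.sum_mem _ fun j _ => ?_) _
  rw [Matrix.conjTranspose_smul, hA]
  exact Subalgebra.smul_mem _ (S.A_mem j) _

open scoped ComplexOrder in
theorem conjTranspose_E (hS : S.IsSymmetric) (i : Fin (d + 1)) :
    (B.E i).conjTranspose = B.E i := by
  obtain ⟨c, hc⟩ := B.exists_mul_E_eq_smul (B.conjTranspose_E_mem hS i) i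
  have hc0 : c ≠ 0 := by
    rintro rfl
    rw [zero_smul, Matrix.conjTranspose_mul_self_eq_zero] at hc
    exact B.E_ne_zero i hc
  have hEE : B.E i * B.E i = B.E i := by rw [E_mul_E, if_pos rfl]
  have hadj : star c • (B.E i).conjTranspose = c • B.E i := by
    have h := congrArg Matrix.conjTranspose hc
    rw [Matrix.conjTranspose_mul, Matrix.conjTranspose_conjTranspose, hc,
      Matrix.conjTranspose_smul] at h
    exact h.symm
  -- Multiplying `hadj` by `E i` on the right gives `star c * c = c`, so `c = 1`.
  have h := congrArg (· * B.E i) hadj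
  simp only [smul_mul_assoc, hc, hEE, smul_smul] at h
  have h1 : star c * c = c := smul_left_injective ℂ (B.E_ne_zero i) h
  have h2 : star c = 1 := mul_right_cancel₀ hc0 (h1.trans (one_mul c).symm)
  have h3 : c = 1 := by rw [← star_star c, h2, star_one]
  simpa [h3] using hadj

theorem conj_E_apply (hS : S.IsSymmetric) (i : Fin (d + 1)) (x y : V) :
    (starRingEnd ℂ) (B.E i x y) = B.E i x y := by
  have h1 := congrFun (congrFun (B.conjTranspose_E hS i) y) x
  have h2 := congrFun (congrFun (B.transpose_E hS i) y) x
  exact h1.trans h2.symm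

/-- The real matrix whose complexification is `E_I`, for a symmetric scheme. -/
noncomputable def realEI (I : Finset (Fin (d + 1))) : Matrix V V ℝ :=
  (B.EI I).map Complex.re

theorem ofReal_realEI_apply (hS : S.IsSymmetric) (I : Finset (Fin (d + 1))) (x y : V) :
    (B.realEI I x y : ℂ) = B.EI I x y := by
  refine Complex.conj_eq_iff_re.1 ?_
  rw [EI, Matrix.sum_apply, map_sum]
  exact Finset.sum_congr rfl fun i _ => B.conj_E_apply hS i x y

theorem map_realEI (hS : S.IsSymmetric) (I : Finset (Fin (d + 1))) :
    (B.realEI I).map Complex.ofReal = B.EI I := by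
  ext x y
  exact B.ofReal_realEI_apply hS I x y

theorem isIdempotentElem_realEI (hS : S.IsSymmetric) (I : Finset (Fin (d + 1))) :
    IsIdempotentElem (B.realEI I) := by
  apply Matrix.map_injective Complex.ofReal_injective
  have h := Matrix.map_mul (L := B.realEI I) (M := B.realEI I) (f := Complex.ofRealHom)
  refine h.trans ?_
  change (B.realEI I).map Complex.ofReal * (B.realEI I).map Complex.ofReal =
    (B.realEI I).map Complex.ofReal
  rw [B.map_realEI hS]
  exact B.isIdempotentElem_EI I

theorem isSymm_realEI (hS : S.IsSymmetric) (I : Finset (Fin (d + 1))) :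
    (B.realEI I).IsSymm := by
  have h : (B.EI I).transpose = B.EI I := by
    rw [EI, Matrix.transpose_sum]
    exact Finset.sum_congr rfl fun i _ => B.transpose_E hS i
  rw [Matrix.IsSymm, realEI, ← Matrix.transpose_map, h]

/-! ### Non-scalarity, and adjacency in the graph of a union of relations -/

/-- For nonempty proper `I`, the idempotent `E_I` is neither `0` nor `1`, so it is not scalar. -/
theorem EI_ne_smul_one {I : Finset (Fin (d + 1))} (hne : I.Nonempty) (hI : I ⊂ Finset.univ)
    (a : ℂ) : B.EI I ≠ a • 1 := by
  intro h
  obtain ⟨k, hk⟩ := hne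
  obtain ⟨l, -, hl⟩ := Finset.exists_of_ssubset hI
  have h1 := B.EI_mul_E I l
  rw [h, if_neg hl, smul_mul_assoc, one_mul] at h1
  have ha : a = 0 := (smul_eq_zero.1 h1).resolve_right (B.E_ne_zero l)
  have h2 := B.EI_mul_E I k
  rw [h, if_pos hk, ha, zero_smul, zero_mul] at h2
  exact B.E_ne_zero k h2.symm

end IdempotentBasis

theorem graph_adj_iff (S : AssocScheme V d) (hS : S.IsSymmetric) (J : Finset (Fin (d + 1)))
    (hJ : 0 ∉ J) {j : Fin (d + 1)} {x y : V} (h : S.A j x y = 1) :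
    (S.graph hS J hJ).Adj x y ↔ j ∈ J := by
  change (∑ i ∈ J, S.A i) x y = 1 ↔ j ∈ J
  rw [Matrix.sum_apply]
  by_cases hj : j ∈ J
  · rw [Finset.sum_eq_single_of_mem j hj fun k _ hk => S.A_apply_eq_zero hk.symm h, h]
    simp [hj]
  · rw [Finset.sum_eq_zero fun k hk =>
      S.A_apply_eq_zero (i := j) (by rintro rfl; exact hj hk) h]
    simp [hj]

end AssocScheme

/-! ### Numbers of distinct eigenvalues -/

theorem numEigenvalues_eq_ncard_spectrum {V : Type*} [Fintype V] [DecidableEq V]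
    (M : Matrix V V ℝ) : numEigenvalues M = (spectrum ℝ M).ncard := by
  rw [numEigenvalues, ← Matrix.spectrum_toLin' M]
  congr 1
  ext μ
  exact Module.End.hasEigenvalue_iff_mem_spectrum

theorem numEigenvalues_le_two_of_isIdempotentElem {V : Type*} [Fintype V] [DecidableEq V]
    {M : Matrix V V ℝ} (hM : IsIdempotentElem M) : numEigenvalues M ≤ 2 := by
  rw [numEigenvalues_eq_ncard_spectrum]
  exact (Set.ncard_le_ncard (hM.spectrum_subset ℝ) (Set.toFinite _)).trans (Set.ncard_pair zero_ne_one).le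

/-- A real symmetric matrix with a nonzero off-diagonal entry is not scalar, so by the spectral
theorem it has two distinct eigenvalues. -/
theorem two_le_numEigenvalues {V : Type*} [Fintype V] [DecidableEq V]
    {M : Matrix V V ℝ} (hM : M.IsSymm) {x y : V} (hxy : x ≠ y) (h : M x y ≠ 0) :
    2 ≤ numEigenvalues M := by
  have hH : M.IsHermitian := hM
  rw [numEigenvalues_eq_ncard_spectrum]
  by_contra! hlt
  have hle : (spectrum ℝ M).ncard ≤ 1 := by omega
  rw [Set.ncard_le_one Matrix.finite_real_spectrum] at hle
  apply h
  have hdiag : Matrix.diagonal (RCLike.ofReal ∘ hH.eigenvalues) =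
      hH.eigenvalues x • (1 : Matrix V V ℝ) := by
    rw [Matrix.smul_one_eq_diagonal]
    congr 1
    ext z
    exact hle _ (hH.eigenvalues_mem_spectrum_real z) _ (hH.eigenvalues_mem_spectrum_real x)
  rw [hH.spectral_theorem, hdiag, map_smul, map_one]
  simp [hxy]

theorem theorem4p1 {V : Type*} [Fintype V] [DecidableEq V] {d : ℕ}
    (S : AssocScheme V d) (hS : S.IsSymmetric) (B : S.IdempotentBasis)
    (I J : Finset (Fin (d + 1))) (hI : I ⊂ Finset.univ) (hJ : 0 ∉ J)
    (hIJ : ∀ j, (∑ i ∈ I, B.m i * B.P j i / B.P j 0) ≠ 0 ↔ j ∈ insert 0 J) :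
    IsIdempotentElem (B.EI I) ∧
      (∃ M ∈ graphMatrices (S.graph hS J hJ), M.map Complex.ofReal = B.EI I) ∧
      minNumEigenvalues (S.graph hS J hJ) = 2 := by
  have hentry : ∀ {j x y}, S.A j x y = 1 → (B.EI I x y = 0 ↔ j ∉ insert 0 J) := by
    intro j x y h
    rw [B.EI_apply hS I h, mul_eq_zero, or_iff_right (one_div_ne_zero S.card_ne_zero),
      ← hIJ j, not_not]
  have hrel : ∀ {j x y}, x ≠ y → S.A j x y = 1 → j ≠ 0 := by
    rintro j x y hxy h rfl
    simp [S.A_zero, hxy] at h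
  have hmem : B.realEI I ∈ graphMatrices (S.graph hS J hJ) := by
    refine ⟨B.isSymm_realEI hS I, fun x y hxy => ?_⟩
    obtain ⟨j, hj⟩ := S.exists_rel x y
    rw [S.graph_adj_iff hS J hJ hj, ← Complex.ofReal_eq_zero, B.ofReal_realEI_apply hS, hentry hj,
      Finset.mem_insert, or_iff_right (hrel hxy hj)]
  have hne : I.Nonempty := by
    rw [Finset.nonempty_iff_ne_empty]
    rintro rfl
    exact (hIJ 0).2 (Finset.mem_insert_self 0 J) Finset.sum_empty
  -- If `J` were empty, `E_I` would be diagonal, with the same entry everywhere on the diagonal.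
  have hJne : J.Nonempty := by
    rw [Finset.nonempty_iff_ne_empty]
    rintro rfl
    refine B.EI_ne_smul_one hne hI
      (1 / (Fintype.card V : ℂ) * ∑ i ∈ I, B.m i * B.P 0 i / B.P 0 0) ?_
    ext x y
    by_cases hxy : x = y
    · subst hxy
      rw [B.EI_apply hS I (j := 0) (by simp [S.A_zero])]
      simp
    · obtain ⟨j, hj⟩ := S.exists_rel x y
      rw [(hentry hj).2 (by simpa using hrel hxy hj)]
      simp [hxy]
  obtain ⟨j, hj⟩ := hJne
  obtain ⟨x, y, hxy⟩ := S.exists_apply_eq_one j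
  have hadj : (S.graph hS J hJ).Adj x y := (S.graph_adj_iff hS J hJ hxy).2 hj
  have hlow : ∀ M ∈ graphMatrices (S.graph hS J hJ), 2 ≤ numEigenvalues M := fun M hM =>
    two_le_numEigenvalues hM.1 hadj.ne fun h0 => (hM.2 x y hadj.ne).1 h0 hadj
  refine ⟨B.isIdempotentElem_EI I, ⟨_, hmem, B.map_realEI hS I⟩, le_antisymm ?_ ?_⟩
  · exact (Nat.sInf_le (Set.mem_image_of_mem _ hmem)).trans
      (numEigenvalues_le_two_of_isIdempotentElem (B.isIdempotentElem_realEI hS I))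
  · refine le_csInf ⟨_, Set.mem_image_of_mem _ hmem⟩ ?_
    rintro _ ⟨M, hM, rfl⟩
    exact hlow M hM
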